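/- Let $G=(V,E)$ be a (simple, undirected) graph of arbitrary cardinality. A \emph{comb} in $G$ is the union of a ray (a one-way infinite path) $R\subseteq G$ with infinitely many pairwise disjoint finite paths in $G$ (possibly consisting of a single vertex), each having precisely its first vertex on $R$; the last vertices of these paths are the \emph{teeth} of the comb. A \emph{brush} in $G$ is a comb in $G$ all of whose teeth have infinite degree in $G$. A function $\pi\colon V\to\{0,1\}$ is an \emph{unfriendly partition} of $G$ if every vertex $x\in V$ has, as cardinals, at least as many neighbours $y$ with $\pi(y)\neq\pi(x)$ as neighbours $y$ with $\pi(y)=\pi(x)$. Theorem. Every graph that contains no brush (equivalently, no ray linked disjointly to infinitely many vertices of infinite degree) has an unfriendly partition. -/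

import Mathlib

universe u

namespace SimpleGraph

variable {V : Type u}

/-- The friends of `x` in the partition `π`: its neighbours in the same class. -/
def friends (G : SimpleGraph V) (π : V → Fin 2) (x : V) : Set V :=
  {y | G.Adj x y ∧ π y = π x}

/-- The opponents of `x` in the partition `π`: its neighbours in the other class. -/
def opponents (G : SimpleGraph V) (π : V → Fin 2) (x : V) : Set V :=
  {y | G.Adj x y ∧ π y ≠ π x}

/-- `x` is happy in `π` if it has at least as many opponents as friends (as cardinals). -/
def IsHappy (G : SimpleGraph V) (π : V → Fin 2) (x : V) : Prop :=
  Cardinal.mk (G.friends π x) ≤ Cardinal.mk (G.opponents π x)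

/-- A partition is unfriendly if every vertex is happy in it. -/
def IsUnfriendly (G : SimpleGraph V) (π : V → Fin 2) : Prop :=
  ∀ x, G.IsHappy π x

/-- A one-way infinite path in `G`, given by its sequence of distinct vertices. -/
structure IsRay (G : SimpleGraph V) (r : ℕ → V) : Prop where
  injective : Function.Injective r
  adj : ∀ n, G.Adj (r n) (r (n + 1))

/-- A comb in `G`: a ray together with infinitely many pairwise disjoint finite paths (possibly
of length zero), each having precisely its first vertex on the ray. The last vertices of these
paths are the teeth. -/
structure Comb (G : SimpleGraph V) where
  /-- The spine of the comb. -/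
  ray : ℕ → V
  isRay : G.IsRay ray
  /-- The first vertices of the paths. -/
  foot : ℕ → V
  /-- The last vertices of the paths. -/
  tooth : ℕ → V
  /-- The paths. -/
  path : ∀ i, G.Walk (foot i) (tooth i)
  isPath : ∀ i, (path i).IsPath
  mem_range_ray_iff : ∀ i, ∀ v ∈ (path i).support, v ∈ Set.range ray ↔ v = foot i
  disjoint : ∀ i j, i ≠ j → (path i).support.Disjoint (path j).support

/-- A comb in `G` is a brush if all its teeth have infinite degree in `G`. -/
def Comb.IsBrush {G : SimpleGraph V} (C : G.Comb) : Prop :=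
  ∀ i, (G.neighborSet (C.tooth i)).Infinite

end SimpleGraph

/-! In a finite graph, a partition with the fewest friendly edges is unfriendly. In general
`IsOptimal` keeps the trace of this that survives: no finite recolouring of vertices of finite
degree lowers the count. This makes vertices of finite degree happy (`IsOptimal.isHappy`). A vertex
of infinite degree is happy iff it has as many opponents as neighbours, and this survives the
recolouring of fewer neighbours than its degree (`IsHappy.of_agree`).

Call a vertex set small if it is hereditarily extendable. Sets of vertices of finite degree are
small by compactness; a set is small if all its components are
(`isHereditarilyExtendable_of_componentIn`); and adding finitely many vertices preserves smallness.
The delicate case is a new vertex of infinite degree (`isExtendable_insert_of_infinite`), where a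
subset of the old set must be recoloured: hence the notion is hereditary.

If the whole vertex set is not small, neither is some component. It contains a vertex of infinite
degree; deleting a finite path to that vertex leaves a set that is not small, which again has a
component that is not small, joined to the path. Iterating yields a brush
(`BrushStage.exists_isBrush`). -/

namespace SimpleGraph

variable {V : Type u} {G : SimpleGraph V}

open Cardinal

/-! ### Counting friendly edges; optimal partitions. -/

open Classical in
/-- The indicator function of the edges of `G` whose ends are friends in `π`. -/
noncomputable def friendly (G : SimpleGraph V) (π : V → Fin 2) (e : Sym2 V) : ℤ :=
  if e ∈ G.edgeSet ∧ (e.map π).IsDiag then 1 else 0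

/-- The change at `e` of the number of friendly edges when passing from `π` to `ρ`. -/
noncomputable def shift (G : SimpleGraph V) (π ρ : V → Fin 2) (e : Sym2 V) : ℤ :=
  G.friendly ρ e - G.friendly π e

/-- The total change of the number of friendly edges when passing from `π` to `ρ`. -/
noncomputable def cost (G : SimpleGraph V) (π ρ : V → Fin 2) : ℤ :=
  ∑ᶠ e, G.shift π ρ e

/-- `ρ` arises from `π` by recolouring finitely many vertices of `W`, all of finite degree. -/
structure IsMove (G : SimpleGraph V) (W : Set V) (π ρ : V → Fin 2) : Prop where
  finite : {x | ρ x ≠ π x}.Finite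
  mem : ∀ x, ρ x ≠ π x → x ∈ W
  degree : ∀ x, ρ x ≠ π x → (G.neighborSet x).Finite

/-- No move inside `W` decreases the number of friendly edges. -/
def IsOptimal (G : SimpleGraph V) (W : Set V) (π : V → Fin 2) : Prop :=
  ∀ ρ, G.IsMove W π ρ → 0 ≤ G.cost π ρ

open Classical in
lemma friendly_mk {x y : V} (h : G.Adj x y) (π : V → Fin 2) :
    G.friendly π s(x, y) = if π x = π y then 1 else 0 := by
  simp [friendly, h]

lemma friendly_of_notMem {e : Sym2 V} (h : e ∉ G.edgeSet) (π : V → Fin 2) :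
    G.friendly π e = 0 := by
  simp [friendly, h]

lemma shift_of_notMem {e : Sym2 V} (h : e ∉ G.edgeSet) (π ρ : V → Fin 2) :
    G.shift π ρ e = 0 := by
  simp [shift, friendly_of_notMem h]

lemma friendly_nonneg (π : V → Fin 2) (e : Sym2 V) : 0 ≤ G.friendly π e := by
  unfold friendly; split_ifs <;> simp

lemma friendly_le_one (π : V → Fin 2) (e : Sym2 V) : G.friendly π e ≤ 1 := by
  unfold friendly; split_ifs <;> simp

lemma IsMove.mono {W W' : Set V} {π ρ : V → Fin 2} (h : G.IsMove W π ρ) (hW : W ⊆ W') :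
    G.IsMove W' π ρ :=
  ⟨h.finite, fun x hx => hW (h.mem x hx), h.degree⟩

lemma IsMove.eq_of_notMem {W : Set V} {π ρ : V → Fin 2} (h : G.IsMove W π ρ) {x : V}
    (hx : x ∉ W) : ρ x = π x := by
  by_contra hne
  exact hx (h.mem x hne)

lemma IsMove.trans {W : Set V} {π ρ σ : V → Fin 2} (h : G.IsMove W π ρ) (h' : G.IsMove W ρ σ) :
    G.IsMove W π σ := by
  have key : ∀ x, σ x ≠ π x → ρ x ≠ π x ∨ σ x ≠ ρ x := by
    intro x hx
    by_contra! hc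
    exact hx (hc.2.trans hc.1)
  refine ⟨(h.finite.union h'.finite).subset key, fun x hx => ?_, fun x hx => ?_⟩
  · exact (key x hx).elim (h.mem x) (h'.mem x)
  · exact (key x hx).elim (h.degree x) (h'.degree x)

/-- Moves can be carried over to any colouring pair with a smaller set of changes. -/
lemma IsMove.of_imp {W W' : Set V} {π ρ π' ρ' : V → Fin 2} (h : G.IsMove W π ρ)
    (himp : ∀ x, ρ' x ≠ π' x → ρ x ≠ π x ∧ x ∈ W') : G.IsMove W' π' ρ' :=
  ⟨h.finite.subset fun x hx => (himp x hx).1, fun x hx => (himp x hx).2,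
    fun x hx => h.degree x (himp x hx).1⟩

lemma IsMove.finite_support {W : Set V} {π ρ : V → Fin 2} (h : G.IsMove W π ρ) :
    (Function.support (G.shift π ρ)).Finite := by
  have hfin : (⋃ x ∈ {x | ρ x ≠ π x}, (fun y => s(x, y)) '' G.neighborSet x).Finite :=
    h.finite.biUnion fun x hx => (h.degree x hx).image _
  refine hfin.subset fun e he => ?_
  induction e using Sym2.ind with
  | _ x y =>
    by_cases hadj : G.Adj x y
    · by_cases hx : ρ x = π x
      · by_cases hy : ρ y = π y
        · simp [shift, friendly_mk hadj, hx, hy] at he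
        · simp only [Set.mem_iUnion]
          exact ⟨y, hy, x, hadj.symm, Sym2.eq_swap⟩
      · simp only [Set.mem_iUnion]
        exact ⟨x, hx, y, hadj, rfl⟩
    · exact absurd (shift_of_notMem (by simpa using hadj) π ρ) he

lemma cost_add {W : Set V} {π ρ σ : V → Fin 2} (h : G.IsMove W π ρ) (h' : G.IsMove W ρ σ) :
    G.cost π σ = G.cost π ρ + G.cost ρ σ := by
  unfold cost
  rw [← finsum_add_distrib h.finite_support h'.finite_support]
  refine finsum_congr fun e => ?_
  simp only [shift]; ring

/-- Every shift lies between -1 and 1, so each uncontrolled edge, in `T`, loses at most 2. -/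
lemma cost_le_cost_add {W W' : Set V} {π ρ π' ρ' : V → Fin 2} (h : G.IsMove W π ρ)
    (h' : G.IsMove W' π' ρ') (T : Finset (Sym2 V))
    (hT : ∀ x y, G.Adj x y → s(x, y) ∉ T → G.shift π ρ s(x, y) ≤ G.shift π' ρ' s(x, y)) :
    G.cost π ρ ≤ G.cost π' ρ' + 2 * T.card := by
  classical
  set S := h.finite_support.toFinset ∪ h'.finite_support.toFinset ∪ T with hS
  have h1 : G.cost π ρ = ∑ e ∈ S, G.shift π ρ e :=
    finsum_eq_sum_of_support_subset _ (by intro e he; simp only [hS, Finset.coe_union, Set.Finite.coe_toFinset]; exact .inl (.inl he))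
  have h2 : G.cost π' ρ' = ∑ e ∈ S, G.shift π' ρ' e :=
    finsum_eq_sum_of_support_subset _ (by intro e he; simp only [hS, Finset.coe_union, Set.Finite.coe_toFinset]; exact .inl (.inr he))
  have h3 : (2 * T.card : ℤ) = ∑ e ∈ S, if e ∈ T then 2 else 0 := by
    rw [Finset.sum_ite_mem, Finset.inter_eq_right.2 Finset.subset_union_right]
    simp [mul_comm]
  rw [h1, h2, h3, ← Finset.sum_add_distrib]
  refine Finset.sum_le_sum fun e _ => ?_
  by_cases heT : e ∈ T
  · have := G.friendly_nonneg π e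
    have := G.friendly_nonneg ρ' e
    have := G.friendly_le_one ρ e
    have := G.friendly_le_one π' e
    simp only [heT, if_true, shift]
    linarith
  · simp only [heT, if_false, add_zero]
    induction e using Sym2.ind with
    | _ x y =>
      by_cases hadj : G.Adj x y
      · exact hT x y hadj heT
      · have he : s(x, y) ∉ G.edgeSet := by simpa using hadj
        simp [shift_of_notMem he]

lemma cost_le_cost {W W' : Set V} {π ρ π' ρ' : V → Fin 2} (h : G.IsMove W π ρ)
    (h' : G.IsMove W' π' ρ')
    (hle : ∀ x y, G.Adj x y → ρ x = π x → ρ y = π y → ρ' x = π' x ∧ ρ' y = π' y)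
    (hT : ∀ x y, G.Adj x y → ρ x ≠ π x → G.shift π ρ s(x, y) ≤ G.shift π' ρ' s(x, y)) :
    G.cost π ρ ≤ G.cost π' ρ' := by
  have := cost_le_cost_add h h' ∅ (fun x y hadj _ => ?_)
  · simpa using this
  by_cases hx : ρ x = π x
  · by_cases hy : ρ y = π y
    · obtain ⟨hx', hy'⟩ := hle x y hadj hx hy
      simp [shift, friendly_mk hadj, hx, hy, hx', hy']
    · rw [Sym2.eq_swap]
      exact hT y x hadj.symm hy
  · exact hT x y hadj hx

/-- A partition whose moves have costs bounded below admits a move to an optimal partition. -/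
lemma exists_isMove_isOptimal {W : Set V} {π : V → Fin 2} (N : ℤ)
    (hN : ∀ ρ, G.IsMove W π ρ → N ≤ G.cost π ρ) :
    ∃ ρ, G.IsMove W π ρ ∧ G.IsOptimal W ρ := by
  have hrefl : G.IsMove W π π := ⟨by simp, by simp, by simp⟩
  obtain ⟨n, ⟨ρ, hρ, rfl⟩, hmin⟩ := Int.exists_least_of_bdd
    (P := fun n => ∃ ρ, G.IsMove W π ρ ∧ G.cost π ρ = n)
    ⟨N, by rintro _ ⟨ρ, hρ, rfl⟩; exact hN ρ hρ⟩ ⟨_, π, hrefl, rfl⟩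
  refine ⟨ρ, hρ, fun σ hσ => ?_⟩
  have := hmin _ ⟨σ, hρ.trans hσ, rfl⟩
  rw [cost_add hρ hσ] at this
  linarith

/-- Vertices of finite degree are happy in an optimal partition. -/
lemma IsOptimal.isHappy {W : Set V} {π : V → Fin 2} (h : G.IsOptimal W π) {x : V} (hx : x ∈ W)
    (hfin : (G.neighborSet x).Finite) : G.IsHappy π x := by
  classical
  have hsym : ∀ a b : Fin 2, 1 - a = b ↔ b ≠ a := by decide
  set ρ := Function.update π x (1 - π x) with hρ
  have hmove : G.IsMove W π ρ := by
    have key : ∀ y, ρ y ≠ π y → y = x := by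
      intro y hy
      by_contra hyx
      exact hy (by simp [hρ, hyx])
    refine ⟨(Set.finite_singleton x).subset key, ?_, ?_⟩
    · intro y hy; rw [key y hy]; exact hx
    · intro y hy; rw [key y hy]; exact hfin
  have hcost := h ρ hmove
  -- Flipping `x` alone affects only the edges at `x`, so the cost is the number of opponents minus
  -- the number of friends.
  have hsum : G.cost π ρ = ∑ y ∈ hfin.toFinset, G.shift π ρ s(x, y) := by
    rw [cost, ← Finset.sum_image (s := hfin.toFinset) (g := fun y => s(x, y))
      (f := G.shift π ρ) (fun a _ b _ hab => Sym2.congr_right.1 hab)]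
    refine finsum_eq_sum_of_support_subset _ fun e he => ?_
    induction e using Sym2.ind with
    | _ a b =>
      by_cases hadj : G.Adj a b
      · by_cases ha : a = x
        · subst ha
          simpa using ⟨b, hadj, Or.inl rfl⟩
        · by_cases hb : b = x
          · subst hb
            simpa using ⟨a, hadj.symm, by simp⟩
          · simp [shift, friendly_mk hadj, hρ, ha, hb] at he
      · exact absurd (shift_of_notMem (by simpa using hadj) π ρ) he
  have hshift : ∀ y ∈ hfin.toFinset, G.shift π ρ s(x, y) =
      (if π y ≠ π x then 1 else 0) - (if π y = π x then 1 else 0) := by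
    intro y hy
    have hadj : G.Adj x y := by simpa using hy
    have hyx : y ≠ x := hadj.ne'
    simp only [shift, friendly_mk hadj, hρ, Function.update_self, Function.update_of_ne hyx, hsym,
      eq_comm (a := π x)]
  rw [hsum, Finset.sum_congr rfl hshift, Finset.sum_sub_distrib, Finset.sum_boole,
    Finset.sum_boole] at hcost
  have hf : G.friends π x = ↑(hfin.toFinset.filter fun y => π y = π x) := by
    ext y; simp [friends]
  have ho : G.opponents π x = ↑(hfin.toFinset.filter fun y => π y ≠ π x) := by
    ext y; simp [opponents]
  rw [IsHappy, hf, ho]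
  simp only [Finset.coe_sort_coe, Cardinal.mk_coe_finset]
  exact_mod_cast (sub_nonneg.1 hcost)

/-- An optimal partition makes moves costly also for partitions `χ` that agree with it near the
recoloured vertices, up to neighbours whose change of colour is favourable. -/
lemma IsOptimal.cost_nonneg_of_agree {W W' : Set V} {π χ ρ : V → Fin 2} (hopt : G.IsOptimal W π)
    (h : G.IsMove W' χ ρ) (hW : ∀ x, ρ x ≠ χ x → x ∈ W) (heq : ∀ x, ρ x ≠ χ x → π x = χ x)
    (hnb : ∀ x y, ρ x ≠ χ x → G.Adj x y → π y = χ y ∨ π y = π x) : 0 ≤ G.cost χ ρ := by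
  classical
  -- The recolouring from `χ` to `ρ`, carried out on `π` instead.
  set σ : V → Fin 2 := fun x => if ρ x ≠ χ x then ρ x else π x with hσ
  have hσ' : ∀ x, σ x ≠ π x ↔ ρ x ≠ χ x := by
    intro x
    by_cases hx : ρ x = χ x
    · simp [hσ, hx]
    · have := heq x hx
      simp only [hσ, if_pos hx, ne_eq, this]
  have hmove : G.IsMove W π σ := h.of_imp fun x hx => ⟨(hσ' x).1 hx, hW x ((hσ' x).1 hx)⟩
  refine (hopt σ hmove).trans (cost_le_cost hmove h (fun x y _ hx hy => ?_) fun x y hadj hx => ?_)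
  · have h1 := (hσ' x).not.1 (not_not.2 hx)
    have h2 := (hσ' y).not.1 (not_not.2 hy)
    exact ⟨not_not.1 h1, not_not.1 h2⟩
  · have hx' := (hσ' x).1 hx
    have hxπ := heq x hx'
    have hσx : σ x = ρ x := by simp [hσ, hx']
    simp only [shift, friendly_mk hadj, hσx]
    by_cases hy : π y = χ y
    · have hσy : σ y = ρ y := by
        by_cases hy' : ρ y = χ y
        · simp [hσ, hy', hy]
        · simp [hσ, hy']
      rw [hσy, hxπ, hy]
    -- This edge is friendly in `π` but not in `χ`: its shift is -1 from `π` and nonnegative from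
    -- `χ`.
    · have hyx := (hnb x y hx' hadj).resolve_left hy
      have hy' : ρ y = χ y := by
        by_contra hc
        exact hy (heq y hc)
      have hσy : σ y = π y := by simp [hσ, hy']
      rw [hσy, hy', hyx]
      have : ρ x ≠ π x := by rw [hxπ]; exact hx'
      simp only [this, if_false, if_true]
      split_ifs <;> omega

lemma isMove_refl (W : Set V) (π : V → Fin 2) : G.IsMove W π π := ⟨by simp, by simp, by simp⟩

lemma cost_self (π : V → Fin 2) : G.cost π π = 0 := by simp [cost, shift]

lemma exists_isOptimal_of_finite {W : Set V} (hW : W.Finite)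
    (hdeg : ∀ x ∈ W, (G.neighborSet x).Finite) (π : V → Fin 2) :
    ∃ ρ, G.IsMove W π ρ ∧ G.IsOptimal W ρ := by
  have hfin : (⋃ x ∈ W, (fun y => s(x, y)) '' G.neighborSet x).Finite :=
    hW.biUnion fun x hx => (hdeg x hx).image _
  refine exists_isMove_isOptimal (-(2 * hfin.toFinset.card)) fun ρ hρ => ?_
  have := cost_le_cost_add (isMove_refl W π) hρ hfin.toFinset fun x y hadj hT => ?_
  · rw [cost_self] at this
    linarith
  · have hT' : ∀ z ∈ W, ∀ w, G.Adj z w → s(z, w) ≠ s(x, y) := by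
      intro z hz w hzw he
      refine hT (hfin.mem_toFinset.2 ?_)
      simp only [Set.mem_iUnion]
      exact ⟨z, hz, w, hzw, he⟩
    have hx : ρ x = π x := hρ.eq_of_notMem fun hx => hT' x hx y hadj rfl
    have hy : ρ y = π y := hρ.eq_of_notMem fun hy => hT' y hy x hadj.symm Sym2.eq_swap
    simp [shift, friendly_mk hadj, hx, hy]

/-! ### Good partitions, and compactness for finite degrees. -/

/-- A partition is good on `W` if it is optimal there and makes all vertices of infinite degree
happy. -/
structure IsGood (G : SimpleGraph V) (W : Set V) (π : V → Fin 2) : Prop where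
  isHappy : ∀ x ∈ W, (G.neighborSet x).Infinite → G.IsHappy π x
  isOptimal : G.IsOptimal W π

/-- Every partition can be recoloured inside `W` so as to become good on `W`. -/
def IsExtendable (G : SimpleGraph V) (W : Set V) : Prop :=
  ∀ f : V → Fin 2, ∃ g, (∀ x ∉ W, g x = f x) ∧ G.IsGood W g

/-- All subsets of `W` are extendable. -/
def IsHereditarilyExtendable (G : SimpleGraph V) (W : Set V) : Prop :=
  ∀ W' ⊆ W, G.IsExtendable W'

lemma IsHereditarilyExtendable.mono {W W' : Set V} (h : G.IsHereditarilyExtendable W)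
    (hW : W' ⊆ W) : G.IsHereditarilyExtendable W' :=
  fun _ h' => h _ (h'.trans hW)

lemma isHereditarilyExtendable_of_finite_degree {W : Set V}
    (hdeg : ∀ x ∈ W, (G.neighborSet x).Finite) : G.IsHereditarilyExtendable W := by
  classical
  intro W' hW' f
  have hex : ∀ D : Finset V, ∃ ρ, G.IsMove (↑D ∩ W') f ρ ∧ G.IsOptimal (↑D ∩ W') ρ := fun D =>
    exists_isOptimal_of_finite (D.finite_toSet.inter_of_left _)
      (fun x hx => hdeg x (hW' hx.2)) f
  choose g hmove hopt using hex
  -- On every finite set `χ` agrees with a partition optimal on a larger finite part of `W'`. A move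
  -- and the neighbours of its vertices form a finite set, so `χ` inherits optimality.
  obtain ⟨χ, hχ⟩ := Finset.rado_selection g
  refine ⟨χ, fun x hx => ?_, fun x hx hinf => absurd (hdeg x (hW' hx)) hinf, fun ρ hρ => ?_⟩
  · obtain ⟨t, -, ht⟩ := hχ {x}
    rw [ht x (by simp)]
    exact (hmove t).eq_of_notMem fun h => hx h.2
  · have hfin : ({x | ρ x ≠ χ x} ∪ ⋃ x ∈ {x | ρ x ≠ χ x}, G.neighborSet x).Finite :=
      hρ.finite.union (hρ.finite.biUnion fun x hx => hρ.degree x hx)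
    obtain ⟨t, hst, ht⟩ := hχ hfin.toFinset
    refine (hopt t).cost_nonneg_of_agree hρ (fun x hx => ⟨hst ?_, hρ.mem x hx⟩)
      (fun x hx => (ht x ?_).symm) fun x y hx hadj => .inl (ht y ?_).symm
    · exact hfin.mem_toFinset.2 (.inl hx)
    · exact hfin.mem_toFinset.2 (.inl hx)
    · refine hfin.mem_toFinset.2 (.inr ?_)
      simp only [Set.mem_iUnion]
      exact ⟨x, hx, hadj⟩

/-- Happiness of a vertex of infinite degree survives the recolouring of few of its neighbours. -/
lemma IsHappy.of_agree {π ρ : V → Fin 2} {x : V} (h : G.IsHappy π x)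
    (hinf : (G.neighborSet x).Infinite) (hx : ρ x = π x)
    (hlt : #{y | G.Adj x y ∧ ρ y ≠ π y} < #(G.neighborSet x)) : G.IsHappy ρ x := by
  have hinf' : ℵ₀ ≤ #(G.neighborSet x) := by
    rw [← Set.infinite_coe_iff, Cardinal.infinite_iff] at hinf
    exact hinf
  have hπ : #(G.neighborSet x) ≤ #(G.opponents π x) := by
    by_contra! hc
    have hsub : G.neighborSet x ⊆ G.friends π x ∪ G.opponents π x := by
      intro y hy
      by_cases hxy : π y = π x
      exacts [.inl ⟨hy, hxy⟩, .inr ⟨hy, hxy⟩]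
    exact absurd ((mk_le_mk_of_subset hsub).trans (mk_union_le _ _))
      (not_le.2 (add_lt_of_lt hinf' (h.trans_lt hc) hc))
  have hρ : #(G.neighborSet x) ≤ #(G.opponents ρ x) := by
    by_contra! hc
    have hsub : G.opponents π x ⊆ G.opponents ρ x ∪ {y | G.Adj x y ∧ ρ y ≠ π y} := by
      rintro y ⟨hy, hxy⟩
      by_cases hye : ρ y = π y
      · exact .inl ⟨hy, by rwa [hye, hx]⟩
      · exact .inr ⟨hy, hye⟩
    exact absurd (hπ.trans ((mk_le_mk_of_subset hsub).trans (mk_union_le _ _)))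
      (not_le.2 (add_lt_of_lt hinf' hc hlt))
  exact (mk_le_mk_of_subset fun y hy => hy.1).trans hρ

lemma IsHappy.of_finite {π ρ : V → Fin 2} {x : V} (h : G.IsHappy π x)
    (hinf : (G.neighborSet x).Infinite) (hx : ρ x = π x)
    (hfin : {y | G.Adj x y ∧ ρ y ≠ π y}.Finite) : G.IsHappy ρ x :=
  h.of_agree hinf hx <| (Cardinal.lt_aleph0_iff_set_finite.2 hfin).trans_le <|
    Cardinal.infinite_iff.1 (Set.infinite_coe_iff.2 hinf)

/-! ### Gluing along components. -/

/-- The vertex set of the component of `v` in the subgraph of `G` induced by `W`. -/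
def componentIn (G : SimpleGraph V) (W : Set V) (v : V) : Set V :=
  {w | ∃ p : G.Walk v w, ∀ x ∈ p.support, x ∈ W}

lemma mem_componentIn_self {W : Set V} {v : V} (hv : v ∈ W) : v ∈ G.componentIn W v :=
  ⟨.nil, by simpa using hv⟩

lemma componentIn_subset (W : Set V) (v : V) : G.componentIn W v ⊆ W :=
  fun _ ⟨p, hp⟩ => hp _ p.end_mem_support

lemma mem_componentIn_of_adj {W : Set V} {v x y : V} (hx : x ∈ G.componentIn W v)
    (hxy : G.Adj x y) (hy : y ∈ W) : y ∈ G.componentIn W v := by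
  obtain ⟨p, hp⟩ := hx
  refine ⟨p.append (.cons hxy .nil), fun z hz => ?_⟩
  rw [Walk.mem_support_append_iff] at hz
  rcases hz with hz | hz
  · exact hp z hz
  · simp only [Walk.support_cons, Walk.support_nil, List.mem_cons, List.not_mem_nil,
      or_false] at hz
    rcases hz with rfl | rfl
    exacts [hp _ p.end_mem_support, hy]

lemma componentIn_eq {W : Set V} {v w : V} (hw : w ∈ G.componentIn W v) :
    G.componentIn W w = G.componentIn W v := by
  obtain ⟨p, hp⟩ := hw
  ext z
  constructor
  · rintro ⟨q, hq⟩
    refine ⟨p.append q, fun x hx => ?_⟩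
    rw [Walk.mem_support_append_iff] at hx
    exact hx.elim (hp x) (hq x)
  · rintro ⟨q, hq⟩
    refine ⟨p.reverse.append q, fun x hx => ?_⟩
    rw [Walk.mem_support_append_iff, Walk.support_reverse, List.mem_reverse] at hx
    exact hx.elim (hp x) (hq x)

lemma isHereditarilyExtendable_of_componentIn {W : Set V}
    (h : ∀ v ∈ W, G.IsHereditarilyExtendable (G.componentIn W v)) :
    G.IsHereditarilyExtendable W := by
  classical
  intro W' hW' f
  have hex : ∀ C : Set V, ∃ g, (∃ v ∈ W, C = G.componentIn W v) →
      (∀ x ∉ C ∩ W', g x = f x) ∧ G.IsGood (C ∩ W') g := by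
    intro C
    by_cases hC : ∃ v ∈ W, C = G.componentIn W v
    · obtain ⟨v, hv, rfl⟩ := hC
      obtain ⟨g, hg⟩ := h v hv _ Set.inter_subset_left f
      exact ⟨g, fun _ => hg⟩
    · exact ⟨f, fun h => absurd h hC⟩
  choose g hg using hex
  set π : V → Fin 2 := fun x => if x ∈ W' then g (G.componentIn W x) x else f x with hπ
  have hagree : ∀ v ∈ W, ∀ x, x ∈ G.componentIn W v ∨ x ∉ W' →
      g (G.componentIn W v) x = π x := by
    intro v hv x hx
    by_cases hxW : x ∈ W'
    · simp [hπ, hxW, componentIn_eq (hx.resolve_right (not_not.2 hxW))]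
    · simp only [hπ, hxW, if_false]
      exact (hg _ ⟨v, hv, rfl⟩).1 x fun h => hxW h.2
  have hnbr : ∀ v ∈ W, ∀ x ∈ G.componentIn W v, ∀ y, G.Adj x y →
      g (G.componentIn W v) y = π y := by
    intro v hv x hx y hxy
    refine hagree v hv y ?_
    by_cases hy : y ∈ W'
    · exact .inl (mem_componentIn_of_adj hx hxy (hW' hy))
    · exact .inr hy
  refine ⟨π, fun x hx => by simp [hπ, hx], fun x hx hinf => ?_, ?_⟩
  · have hxC := mem_componentIn_self (G := G) (hW' hx)
    refine ((hg _ ⟨x, hW' hx, rfl⟩).2.isHappy x ⟨hxC, hx⟩ hinf).of_finite hinf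
      (hagree x (hW' hx) x (.inl hxC)).symm (Set.finite_empty.subset ?_)
    rintro y ⟨hxy, hy⟩
    exact hy (hnbr x (hW' hx) x hxC y hxy).symm
  -- A move is split off one component at a time, by induction on the number of recoloured vertices.
  · suffices H : ∀ n, ∀ ρ, G.IsMove W' π ρ → {x | ρ x ≠ π x}.ncard = n → 0 ≤ G.cost π ρ from
      fun ρ hρ => H _ ρ hρ rfl
    intro n
    induction n using Nat.strong_induction_on with
    | _ n ih =>
      rintro ρ hρ rfl
      by_cases hne : ρ = π
      · rw [hne, cost_self]
      obtain ⟨x, hx⟩ := Function.ne_iff.1 hne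
      have hxW := hW' (hρ.mem x hx)
      set C := G.componentIn W x with hC
      have hxC : x ∈ C := mem_componentIn_self hxW
      set σ : V → Fin 2 := fun y => if y ∈ C then π y else ρ y with hσ
      have hσπ : ∀ y, σ y ≠ π y → ρ y ≠ π y ∧ y ∉ C := by
        intro y hy
        by_cases hyC : y ∈ C
        · simp [hσ, hyC] at hy
        · exact ⟨by simpa [hσ, hyC] using hy, hyC⟩
      have hρσ : ∀ y, ρ y ≠ σ y → ρ y ≠ π y ∧ y ∈ C := by
        intro y hy
        by_cases hyC : y ∈ C
        · exact ⟨by simpa [hσ, hyC] using hy, hyC⟩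
        · simp [hσ, hyC] at hy
      have h1 : G.IsMove W' π σ := hρ.of_imp fun y hy => ⟨(hσπ y hy).1, hρ.mem y (hσπ y hy).1⟩
      have h2 : G.IsMove W' σ ρ := hρ.of_imp fun y hy => ⟨(hρσ y hy).1, hρ.mem y (hρσ y hy).1⟩
      rw [cost_add h1 h2]
      refine add_nonneg (ih _ (Set.ncard_lt_ncard ⟨fun y hy => (hσπ y hy).1, fun hsub =>
        (hσπ x (hsub hx)).2 hxC⟩ hρ.finite) σ h1 rfl) ?_
      have hgood := hg C ⟨x, hxW, rfl⟩
      refine hgood.2.isOptimal.cost_nonneg_of_agree h2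
        (fun y hy => ⟨(hρσ y hy).2, hρ.mem y (hρσ y hy).1⟩) (fun y hy => ?_)
        fun y z hy hyz => .inl ?_
      · have hyC := (hρσ y hy).2
        rw [hagree x hxW y (.inl hyC)]
        simp [hσ, hyC]
      · have hyC := (hρσ y hy).2
        rw [hnbr x hxW y hyC z hyz]
        by_cases hzC : z ∈ C
        · simp [hσ, hzC]
        · have hz : z ∉ W' := fun hz => hzC (mem_componentIn_of_adj hyC hyz (hW' hz))
          simp [hσ, hzC, hρ.eq_of_notMem hz]

/-! ### Adding one vertex. -/

lemma isExtendable_insert_of_finite {W : Set V} {s : V} (hs : (G.neighborSet s).Finite)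
    (hsW : s ∉ W) (hW : G.IsExtendable W) : G.IsExtendable (insert s W) := by
  classical
  intro f
  obtain ⟨g, hgf, hgood⟩ := hW f
  obtain ⟨ρ, hρ, hopt⟩ := exists_isMove_isOptimal (G := G) (W := insert s W) (π := g)
    (-(2 * (hs.image (fun y => s(s, y))).toFinset.card)) fun ρ hρ => by
      -- Resetting `s` gives a move inside `W`, of nonnegative cost, which differs from `ρ` only in
      -- the finitely many edges at `s`.
      set σ := Function.update ρ s (g s) with hσ
      have hσρ : ∀ y, y ≠ s → σ y = ρ y := fun y hy => by simp [hσ, hy]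
      have hσs : σ s = g s := by simp [hσ]
      have hσg : ∀ y, σ y ≠ g y → y ≠ s := by
        rintro y hy rfl
        exact hy hσs
      have h1 : G.IsMove W g σ := hρ.of_imp fun y hy => by
        have hys := hσg y hy
        rw [hσρ y hys] at hy
        exact ⟨hy, (hρ.mem y hy).resolve_left hys⟩
      have := cost_le_cost_add h1 hρ (hs.image (fun y => s(s, y))).toFinset
        fun x y hadj hT => by
          have hx : x ≠ s := by
            rintro rfl
            exact hT (by simpa using ⟨y, hadj, .inl rfl⟩)
          have hy : y ≠ s := by
            rintro rfl
            exact hT (by simpa using ⟨x, hadj.symm, by simp⟩)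
          simp [shift, friendly_mk hadj, hσρ x hx, hσρ y hy]
      have := hgood.isOptimal σ h1
      linarith
  refine ⟨ρ, fun x hx => ?_, fun x hx hinf => ?_, hopt⟩
  · rw [hρ.eq_of_notMem hx]
    exact hgf x fun h => hx (.inr h)
  · have hxs : x ≠ s := by rintro rfl; exact hinf hs
    refine (hgood.isHappy x (hx.resolve_left hxs) hinf).of_finite hinf ?_
      (hρ.finite.subset fun y hy => hy.2)
    by_contra hne
    exact hinf (hρ.degree x hne)

/-- The vertices reachable from `O` by at most `n` steps inside `L`. -/
def reachStep (G : SimpleGraph V) (L O : Set V) : ℕ → Set V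
  | 0 => O ∩ L
  | n + 1 => G.reachStep L O n ∪ ⋃ x ∈ G.reachStep L O n, (G.neighborSet x ∩ L)

/-- The vertices reachable from `O` inside `L`. -/
def reach (G : SimpleGraph V) (L O : Set V) : Set V := ⋃ n, G.reachStep L O n

lemma reachStep_subset (L O : Set V) (n : ℕ) : G.reachStep L O n ⊆ L := by
  induction n with
  | zero => exact Set.inter_subset_right
  | succ n ih =>
    refine Set.union_subset ih ?_
    exact Set.iUnion₂_subset fun x _ => Set.inter_subset_right

lemma reach_subset (L O : Set V) : G.reach L O ⊆ L := Set.iUnion_subset (reachStep_subset L O)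

lemma inter_subset_reach (L O : Set V) : O ∩ L ⊆ G.reach L O :=
  Set.subset_iUnion (G.reachStep L O) 0

lemma mem_reach_of_adj {L O : Set V} {x y : V} (hx : x ∈ G.reach L O) (hxy : G.Adj x y)
    (hy : y ∈ L) : y ∈ G.reach L O := by
  obtain ⟨n, hn⟩ := Set.mem_iUnion.1 hx
  refine Set.mem_iUnion.2 ⟨n + 1, .inr ?_⟩
  simp only [Set.mem_iUnion]
  exact ⟨x, hn, hxy, hy⟩

lemma mk_reach_le {L O : Set V} {μ : Cardinal.{u}} (hμ : ℵ₀ ≤ μ) (hO : #O ≤ μ)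
    (hL : ∀ x ∈ L, #(G.neighborSet x) ≤ μ) : #(G.reach L O) ≤ μ := by
  have hstep : ∀ n, #(G.reachStep L O n) ≤ μ := by
    intro n
    induction n with
    | zero => exact (mk_le_mk_of_subset Set.inter_subset_left).trans hO
    | succ n ih =>
      refine (mk_union_le _ _).trans ((add_le_add ih ?_).trans (add_eq_self hμ).le)
      refine (mk_biUnion_le _ _).trans ((mul_le_mul' ih (ciSup_le' fun x => ?_)).trans
        (mul_eq_self hμ).le)
      exact (mk_le_mk_of_subset Set.inter_subset_left).trans
        (hL _ (reachStep_subset L O n x.2))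
  have h := mk_iUnion_le_lift (G.reachStep L O)
  rw [lift_uzero] at h
  refine h.trans ?_
  refine (mul_le_mul' (b := μ) (d := μ) (by simpa using hμ) (ciSup_le' fun n => ?_)).trans
    (mul_eq_self hμ).le
  rw [lift_uzero]
  exact hstep n

/-- An unhappy `s` is flipped. This can spoil optimality only through its former opponents `O`, as
edges from `s` to former friends become unfriendly. If `O` is finite, costs stay bounded below and a
finite move restores optimality. Otherwise a set of size at most `#O`, less than the degree of `s`,
is recoloured. -/
lemma isExtendable_insert_of_infinite {W : Set V} {s : V} (hs : (G.neighborSet s).Infinite)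
    (hsW : s ∉ W) (hW : G.IsHereditarilyExtendable W) : G.IsExtendable (insert s W) := by
  classical
  intro f
  obtain ⟨g, hgf, hgood⟩ := hW W subset_rfl f
  by_cases hhappy : G.IsHappy g s
  · refine ⟨g, fun x hx => hgf x fun h => hx (.inr h), ?_, fun ρ hρ => ?_⟩
    · rintro x (rfl | hx) hinf
      exacts [hhappy, hgood.isHappy x hx hinf]
    · refine hgood.isOptimal ρ (hρ.of_imp fun x hx => ⟨hx, (hρ.mem x hx).resolve_left ?_⟩)
      rintro rfl
      exact hs (hρ.degree x hx)
  rw [IsHappy, not_le] at hhappy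
  set O := G.opponents g s with hO
  set g₁ := Function.update g s (1 - g s) with hg₁
  have hne : ∀ a : Fin 2, 1 - a ≠ a := by decide
  have htwo : ∀ a b : Fin 2, b = 1 - a ↔ b ≠ a := by decide
  have hg₁s : g₁ s = 1 - g s := by simp [hg₁]
  have hg₁x : ∀ x, x ≠ s → g₁ x = g x := fun x hx => by simp [hg₁, hx]
  have hsdeg : #O < #(G.neighborSet s) :=
    hhappy.trans_le (mk_le_mk_of_subset fun y hy => hy.1)
  have hOmem : ∀ y, G.Adj s y → y ∉ O → g y = g s := by
    intro y hy hyO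
    by_contra hc
    exact hyO ⟨hy, hc⟩
  have hs₁ : G.IsHappy g₁ s := by
    have h1 : G.friends g₁ s ⊆ O := by
      rintro y ⟨hy, hys⟩
      rw [hg₁s, hg₁x y hy.ne', htwo] at hys
      exact ⟨hy, hys⟩
    have h2 : G.friends g s ⊆ G.opponents g₁ s := by
      rintro y ⟨hy, hys⟩
      refine ⟨hy, ?_⟩
      rw [hg₁s, hg₁x y hy.ne', hys]
      exact (hne _).symm
    exact ((mk_le_mk_of_subset h1).trans hhappy.le).trans (mk_le_mk_of_subset h2)
  by_cases hOfin : O.Finite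
  · obtain ⟨ρ, hρ, hopt⟩ := exists_isMove_isOptimal (G := G) (W := insert s W) (π := g₁)
      (-(2 * (hOfin.image (fun y => s(s, y))).toFinset.card)) fun ρ hρ => by
        have hρs : ρ s = g₁ s := by
          by_contra hc
          exact hs (hρ.degree s hc)
        set σ := Function.update ρ s (g s) with hσ
        have hσρ : ∀ y, y ≠ s → σ y = ρ y := fun y hy => by simp [hσ, hy]
        have hσs : σ s = g s := by simp [hσ]
        have hσg : ∀ y, σ y ≠ g y → y ≠ s := by
          rintro y hy rfl
          exact hy hσs
        have h1 : G.IsMove W g σ := hρ.of_imp fun y hy => by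
          have hys := hσg y hy
          rw [hσρ y hys, ← hg₁x y hys] at hy
          exact ⟨hy, (hρ.mem y hy).resolve_left hys⟩
        have key : ∀ y, G.Adj s y → y ∉ O → G.shift g σ s(s, y) ≤ G.shift g₁ ρ s(s, y) := by
          intro y hy hyO
          have h2 : g₁ s ≠ g₁ y := by
            rw [hg₁s, hg₁x y hy.ne', hOmem y hy hyO]
            exact hne _
          simp only [shift, friendly_mk hy, (hOmem y hy hyO).symm, h2, if_true, if_false]
          split_ifs <;> omega
        have := cost_le_cost_add h1 hρ (hOfin.image (fun y => s(s, y))).toFinset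
          fun x y hadj hT => by
            by_cases hx : x = s
            · subst hx
              exact key y hadj fun hy => hT ((Set.Finite.mem_toFinset _).2 ⟨y, hy, rfl⟩)
            by_cases hy : y = s
            · subst hy
              rw [Sym2.eq_swap]
              exact key x hadj.symm fun hx =>
                hT ((Set.Finite.mem_toFinset _).2 ⟨x, hx, Sym2.eq_swap⟩)
            simp [shift, friendly_mk hadj, hσρ x hx, hσρ y hy, hg₁x x hx, hg₁x y hy]
        have := hgood.isOptimal σ h1
        linarith
    have hinfeq : ∀ x, (G.neighborSet x).Infinite → ρ x = g₁ x := by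
      intro x hinf
      by_contra hc
      exact hinf (hρ.degree x hc)
    refine ⟨ρ, fun x hx => ?_, fun x hx hinf => ?_, hopt⟩
    · rw [hρ.eq_of_notMem hx, hg₁x x fun h => hx (.inl h)]
      exact hgf x fun h => hx (.inr h)
    · rcases hx with rfl | hx
      · exact hs₁.of_finite hinf (hinfeq x hinf) (hρ.finite.subset fun y hy => hy.2)
      · have hxs : x ≠ s := by rintro rfl; exact hsW hx
        refine (hgood.isHappy x hx hinf).of_finite hinf
          ((hinfeq x hinf).trans (hg₁x x hxs)) ((hρ.finite.insert s).subset fun y hy => ?_)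
        by_cases hys : y = s
        · exact .inl hys
        · exact .inr (by simpa only [Set.mem_ofPred_eq, hg₁x y hys] using hy.2)
  · have hμ : ℵ₀ ≤ #O := Cardinal.infinite_iff.1 (Set.infinite_coe_iff.2 hOfin)
    set L := {x ∈ W | #(G.neighborSet x) ≤ #O} with hL
    -- `R` is closed under adjacency in `L`, so vertices of `L` outside `R` see no change except at
    -- `s`. Vertices of degree above `#O` see at most `#O` changes.
    set R := G.reach L O with hR
    have hRL : R ⊆ L := reach_subset L O
    have hRW : R ⊆ W := fun x hx => (hRL hx).1
    have hRcard : #R ≤ #O := mk_reach_le hμ le_rfl fun x hx => hx.2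
    have hRs : s ∉ R := fun h => hsW (hRW h)
    obtain ⟨g₂, hg₂, hgood₂⟩ := hW R hRW g₁
    have hagree : ∀ y, y ∉ R → y ≠ s → g₂ y = g y := fun y hy hys =>
      (hg₂ y hy).trans (hg₁x y hys)
    have hsmall : ∀ x, #O < #(G.neighborSet x) →
        #{y | G.Adj x y ∧ g₂ y ≠ g y} < #(G.neighborSet x) := by
      intro x hx
      have hsub : {y | G.Adj x y ∧ g₂ y ≠ g y} ⊆ insert s R := by
        intro y hy
        by_contra hc
        rw [Set.mem_insert_iff, not_or] at hc
        exact hy.2 (hagree y hc.2 hc.1)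
      refine (mk_le_mk_of_subset hsub).trans_lt (lt_of_le_of_lt ?_ hx)
      exact (mk_insert_le).trans ((add_le_add hRcard (one_le_aleph0.trans hμ)).trans
        (add_eq_self hμ).le)
    refine ⟨g₂, fun x hx => ?_, fun x hx hinf => ?_, fun ρ hρ => ?_⟩
    · rw [hagree x (fun h => hx (.inr (hRW h))) fun h => hx (.inl h)]
      exact hgf x fun h => hx (.inr h)
    · rcases hx with rfl | hx
      · refine hs₁.of_agree hinf (hg₂ x hRs) (lt_of_le_of_lt ?_ hsdeg)
        refine (mk_le_mk_of_subset fun y hy => ?_).trans hRcard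
        by_contra hc
        exact hy.2 (hg₂ y hc)
      · by_cases hxR : x ∈ R
        · exact hgood₂.isHappy x hxR hinf
        have hxs : x ≠ s := by rintro rfl; exact hsW hx
        by_cases hxO : #O < #(G.neighborSet x)
        · exact (hgood.isHappy x hx hinf).of_agree hinf (hagree x hxR hxs) (hsmall x hxO)
        · refine (hgood.isHappy x hx hinf).of_finite hinf (hagree x hxR hxs)
            ((Set.finite_singleton s).subset ?_)
          rintro y ⟨hxy, hy⟩
          by_contra hys
          refine hy (hagree y (fun hyR => hxR ?_) hys)
          exact mem_reach_of_adj hyR hxy.symm ⟨hx, not_lt.1 hxO⟩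
    -- The move is split into its part in `R`, where `g₂` is optimal, and its part in `L` outside
    -- `R`, which is compared with `g`.
    · set σ : V → Fin 2 := fun y => if y ∈ R then ρ y else g₂ y with hσ
      have hσg : ∀ y, σ y ≠ g₂ y → ρ y ≠ g₂ y ∧ y ∈ R := by
        intro y hy
        by_cases hyR : y ∈ R
        · exact ⟨by simpa [hσ, hyR] using hy, hyR⟩
        · simp [hσ, hyR] at hy
      have hρσ : ∀ y, ρ y ≠ σ y → ρ y ≠ g₂ y ∧ y ∉ R := by
        intro y hy
        by_cases hyR : y ∈ R
        · simp [hσ, hyR] at hy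
        · exact ⟨by simpa [hσ, hyR] using hy, hyR⟩
      have h1 : G.IsMove R g₂ σ := hρ.of_imp hσg
      have h2 : G.IsMove (insert s W) σ ρ :=
        hρ.of_imp fun y hy => ⟨(hρσ y hy).1, hρ.mem y (hρσ y hy).1⟩
      have hys : ∀ y, ρ y ≠ σ y → y ≠ s := by
        rintro y hy rfl
        exact hs (h2.degree y hy)
      have hyW : ∀ y, ρ y ≠ σ y → y ∈ W := fun y hy => (h2.mem y hy).resolve_left (hys y hy)
      have hyL : ∀ y, ρ y ≠ σ y → y ∈ L := fun y hy => ⟨hyW y hy,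
        (Cardinal.lt_aleph0_iff_set_finite.2 (h2.degree y hy)).le.trans hμ⟩
      have hσeq : ∀ y, y ∉ R → y ≠ s → g y = σ y := by
        intro y hyR hy
        simp [hσ, hyR, hagree y hyR hy]
      rw [cost_add (h1.mono (Set.subset_union_left (t := insert s W)))
        (h2.mono Set.subset_union_right)]
      refine add_nonneg (hgood₂.isOptimal σ h1) (hgood.isOptimal.cost_nonneg_of_agree h2 hyW
        (fun y hy => hσeq y (hρσ y hy).2 (hys y hy)) fun y z hy hyz => ?_)
      have hyR := (hρσ y hy).2
      by_cases hzs : z = s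
      -- Since `y` is not in `R`, it is not in `O` either, so it was a friend of `s` in `g`: the
      -- flip of `s` is favourable at `y`.
      · subst hzs
        refine .inr (hOmem y hyz.symm fun hyO => hyR ?_).symm
        exact inter_subset_reach L O ⟨hyO, hyL y hy⟩
      · refine .inl (hσeq z (fun hzR => hyR ?_) hzs)
        exact mem_reach_of_adj hzR hyz.symm (hyL y hy)

lemma IsHereditarilyExtendable.insert {W : Set V} (hW : G.IsHereditarilyExtendable W) (s : V) :
    G.IsHereditarilyExtendable (insert s W) := by
  intro W' hW'
  by_cases hs : s ∈ W'
  · have hsub : W' \ {s} ⊆ W := fun x hx => (hW' hx.1).resolve_left hx.2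
    have hns : s ∉ W' \ {s} := fun h => h.2 rfl
    rw [← Set.insert_sdiff_self_of_mem hs]
    by_cases hfin : (G.neighborSet s).Finite
    · exact isExtendable_insert_of_finite hfin hns (hW _ hsub)
    · exact isExtendable_insert_of_infinite hfin hns (hW.mono hsub)
  · refine hW W' fun x hx => (hW' hx).resolve_left ?_
    rintro rfl
    exact hs hx

lemma IsHereditarilyExtendable.of_diff_finite {W S : Set V} (hS : S.Finite)
    (h : G.IsHereditarilyExtendable (W \ S)) : G.IsHereditarilyExtendable W := by
  have : G.IsHereditarilyExtendable (S ∪ W \ S) := by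
    induction S, hS using Set.Finite.induction_on with
    | empty => simpa using h
    | @insert a S ha hS ih =>
      have h' : G.IsHereditarilyExtendable (W \ S) :=
        (h.insert a).mono fun x hx => by
          by_cases hxa : x = a
          · exact .inl hxa
          · exact .inr ⟨hx.1, by simp [hxa, hx.2]⟩
      refine ((ih h').insert a).mono ?_
      rintro x ((rfl | hx) | ⟨hx, hxS⟩)
      · exact .inl rfl
      · exact .inr (.inl hx)
      · exact .inr (.inr ⟨hx, fun h => hxS (.inr h)⟩)
  exact this.mono fun x hx => by
    by_cases hxS : x ∈ S
    exacts [.inl hxS, .inr ⟨hx, hxS⟩]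

lemma IsHereditarilyExtendable.exists_isUnfriendly
    (h : G.IsHereditarilyExtendable Set.univ) : ∃ π : V → Fin 2, G.IsUnfriendly π := by
  obtain ⟨g, -, hg⟩ := h _ subset_rfl fun _ => 0
  refine ⟨g, fun x => ?_⟩
  by_cases hx : (G.neighborSet x).Finite
  · exact hg.isOptimal.isHappy (Set.mem_univ x) hx
  · exact hg.isHappy x (Set.mem_univ x) hx

/-! ### Building a brush. -/

/-- A stage in the construction of a brush: a path to a vertex of infinite degree, and a set that
is avoided by this path but adjacent to it, and that is not hereditarily extendable. -/
structure BrushStage (G : SimpleGraph V) where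
  /-- The first vertex of the path. -/
  head : V
  /-- The last vertex of the path. -/
  tooth : V
  /-- The path. -/
  path : G.Walk head tooth
  isPath : path.IsPath
  infinite : (G.neighborSet tooth).Infinite
  /-- The set in which the construction continues. -/
  rest : Set V
  not_extendable : ¬ G.IsHereditarilyExtendable rest
  eq_componentIn : ∀ v ∈ rest, G.componentIn rest v = rest
  notMem_rest : ∀ v ∈ path.support, v ∉ rest
  exists_adj : ∃ v ∈ path.support, ∃ w ∈ rest, G.Adj v w

namespace BrushStage

/-- The vertices still available at a stage. -/
def carrier (S : G.BrushStage) : Set V := {v | v ∈ S.path.support} ∪ S.rest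

/-- A stage is a branching stage if its first vertex is adjacent to the remaining set. -/
def IsBranching (S : G.BrushStage) : Prop := ∃ w ∈ S.rest, G.Adj S.head w

lemma head_mem_support (S : G.BrushStage) : S.head ∈ S.path.support := S.path.start_mem_support

lemma head_mem_carrier (S : G.BrushStage) : S.head ∈ S.carrier := .inl S.head_mem_support

end BrushStage

lemma componentIn_componentIn {W : Set V} {v w : V} (hw : w ∈ G.componentIn W v) :
    G.componentIn (G.componentIn W v) w = G.componentIn W v := by
  refine (componentIn_subset _ _).antisymm fun z hz => ?_
  rw [← componentIn_eq hw] at hz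
  obtain ⟨p, hp⟩ := hz
  classical
  refine ⟨p, fun x hx => ?_⟩
  rw [← componentIn_eq hw]
  exact ⟨p.takeUntil x hx, fun y hy => hp y (p.support_takeUntil_subset_support hx hy)⟩

lemma exists_componentIn_not_extendable {W : Set V} (h : ¬ G.IsHereditarilyExtendable W) :
    ∃ v ∈ W, ¬ G.IsHereditarilyExtendable (G.componentIn W v) := by
  by_contra! hc
  exact h (isHereditarilyExtendable_of_componentIn hc)

/-- In a connected set that is not hereditarily extendable, a stage can be started anywhere. -/
lemma exists_brushStage {W : Set V} (hW : ¬ G.IsHereditarilyExtendable W)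
    (hconn : ∀ v ∈ W, G.componentIn W v = W) {y : V} (hy : y ∈ W) :
    ∃ S : G.BrushStage, S.head = y ∧ S.carrier ⊆ W := by
  classical
  obtain ⟨u, huW, hu⟩ : ∃ u ∈ W, (G.neighborSet u).Infinite := by
    by_contra! hc
    exact hW (isHereditarilyExtendable_of_finite_degree fun x hx => hc x hx)
  obtain ⟨q, hq⟩ : u ∈ G.componentIn W y := by rwa [hconn y hy]
  set p := q.bypass with hp
  have hpW : ∀ x ∈ p.support, x ∈ W := fun x hx => hq x (q.support_bypass_subset_support hx)
  set Q : Set V := {v | v ∈ p.support} with hQ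
  have hQfin : Q.Finite := p.support.finite_toSet
  obtain ⟨v, hv, hvC⟩ := exists_componentIn_not_extendable
    fun h => hW (IsHereditarilyExtendable.of_diff_finite hQfin h)
  have hsub := componentIn_subset (G := G) (W \ Q) v
  have hadj : ∃ a ∈ p.support, ∃ b ∈ G.componentIn (W \ Q) v, G.Adj a b := by
    obtain ⟨r, hr⟩ : v ∈ G.componentIn W y := by rw [hconn y hy]; exact hv.1
    -- An edge of a walk in `W` entering the component must start on the path, or its first end
    -- would lie in the component too.
    obtain ⟨d, hd, hd1, hd2⟩ := r.exists_boundary_dart (G.componentIn (W \ Q) v)ᶜ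
      (fun h => (hsub h).2 p.start_mem_support) (fun h => h (mem_componentIn_self hv))
    have hd2' : d.snd ∈ G.componentIn (W \ Q) v := not_not.1 hd2
    refine ⟨d.fst, ?_, d.snd, hd2', d.adj⟩
    by_contra hc
    exact hd1 (mem_componentIn_of_adj hd2' d.adj.symm
      ⟨hr _ (r.dart_fst_mem_support_of_mem_darts hd), hc⟩)
  refine ⟨⟨y, u, p, q.bypass_isPath, hu, G.componentIn (W \ Q) v, hvC,
    fun w hw => componentIn_componentIn hw, fun x hx hx' => (hsub hx').2 hx, hadj⟩, rfl, ?_⟩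
  rintro x (hx | hx)
  exacts [hpW x hx, (hsub hx).1]

namespace BrushStage

/-- The ray follows the path until its head sees the remaining set, then steps into that set and
starts afresh. The path left behind becomes a path of the comb. -/
lemma exists_next (S : G.BrushStage) : ∃ T : G.BrushStage, G.Adj S.head T.head ∧
    T.carrier ⊆ S.carrier \ {S.head} ∧ (S.IsBranching → T.carrier ⊆ S.rest) ∧
    (¬ S.IsBranching → T.path.length < S.path.length) := by
  have hnot := S.notMem_rest S.head S.head_mem_support
  by_cases hS : S.IsBranching
  · obtain ⟨w, hw, hadj⟩ := hS
    obtain ⟨T, rfl, hT⟩ := exists_brushStage S.not_extendable S.eq_componentIn hw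
    refine ⟨T, hadj, fun x hx => ⟨.inr (hT hx), ?_⟩, fun _ => hT, fun h => absurd ⟨_, hw, hadj⟩ h⟩
    rintro rfl
    exact hnot (hT hx)
  · obtain ⟨x, u, p, hp, hu, W, hW, hconn, hdisj, hadj⟩ := S
    cases p with
    | nil =>
      obtain ⟨v, hv, w, hw, hvw⟩ := hadj
      obtain rfl : v = x := by simpa using hv
      exact absurd ⟨w, hw, hvw⟩ hS
    | @cons _ y _ hxy p =>
      rw [Walk.cons_isPath_iff] at hp
      have hadj' : ∃ v ∈ p.support, ∃ w ∈ W, G.Adj v w := by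
        obtain ⟨v, hv, w, hw, hvw⟩ := hadj
        rw [Walk.support_cons, List.mem_cons] at hv
        rcases hv with rfl | hv
        · exact absurd ⟨w, hw, hvw⟩ hS
        · exact ⟨v, hv, w, hw, hvw⟩
      refine ⟨⟨y, u, p, hp.1, hu, W, hW, hconn, fun v hv => hdisj v (by simp [hv]), hadj'⟩,
        hxy, ?_, fun h => absurd h hS, fun _ => by simp⟩
      rintro v (hv | hv)
      · exact ⟨.inl (by simpa using Or.inr hv), by rintro rfl; exact hp.2 hv⟩
      · exact ⟨.inr hv, by rintro rfl; exact hnot hv⟩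

/-- The stage following `S`. -/
noncomputable def next (S : G.BrushStage) : G.BrushStage := S.exists_next.choose

/-- The stages obtained by iteration from `S`. -/
noncomputable def stage (S : G.BrushStage) (n : ℕ) : G.BrushStage := next^[n] S

variable (S : G.BrushStage)

lemma stage_succ (n : ℕ) : S.stage (n + 1) = (S.stage n).next :=
  Function.iterate_succ_apply' _ _ _

lemma adj_stage (n : ℕ) : G.Adj (S.stage n).head (S.stage (n + 1)).head := by
  rw [stage_succ]; exact (S.stage n).exists_next.choose_spec.1

lemma carrier_stage_succ (n : ℕ) :
    (S.stage (n + 1)).carrier ⊆ (S.stage n).carrier \ {(S.stage n).head} := by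
  rw [stage_succ]; exact (S.stage n).exists_next.choose_spec.2.1

lemma carrier_stage_antitone : Antitone fun n => (S.stage n).carrier :=
  antitone_nat_of_succ_le fun n => (S.carrier_stage_succ n).trans Set.sdiff_subset

lemma head_stage_notMem {m n : ℕ} (h : m < n) : (S.stage m).head ∉ (S.stage n).carrier :=
  fun hm => (S.carrier_stage_succ m (S.carrier_stage_antitone h hm)).2 rfl

lemma carrier_stage_subset_rest {m n : ℕ} (h : m < n) (hm : (S.stage m).IsBranching) :
    (S.stage n).carrier ⊆ (S.stage m).rest := by
  refine (S.carrier_stage_antitone h).trans ?_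
  simp only [stage_succ]
  exact (S.stage m).exists_next.choose_spec.2.2.1 hm

lemma exists_isBranching_stage (n : ℕ) : ∃ m, n ≤ m ∧ (S.stage m).IsBranching := by
  by_contra! hc
  have hlt : ∀ m, n ≤ m → (S.stage (m + 1)).path.length < (S.stage m).path.length := by
    intro m hm
    rw [stage_succ]
    exact (S.stage m).exists_next.choose_spec.2.2.2 (hc m hm)
  have : ∀ k, (S.stage (n + k)).path.length + k ≤ (S.stage n).path.length := by
    intro k
    induction k with
    | zero => simp
    | succ k ih =>
      have := hlt (n + k) (by omega)
      rw [add_assoc] at this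
      omega
  have := this ((S.stage n).path.length + 1)
  omega

lemma injective_head_stage : Function.Injective fun n => (S.stage n).head := by
  have key : ∀ m n, m < n → (S.stage m).head ≠ (S.stage n).head := fun m n h he =>
    S.head_stage_notMem h (he ▸ (S.stage n).head_mem_carrier)
  intro m n h
  by_contra hne
  rcases lt_or_gt_of_ne hne with hlt | hlt
  exacts [key m n hlt h, key n m hlt h.symm]

lemma exists_isBrush (S : G.BrushStage) : ∃ C : G.Comb, C.IsBrush := by
  classical
  have hinf : {n | (S.stage n).IsBranching}.Infinite := by
    rw [Set.infinite_iff_exists_gt]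
    intro n
    obtain ⟨m, hm, hb⟩ := S.exists_isBranching_stage (n + 1)
    exact ⟨m, hb, hm⟩
  -- Only branching stages contribute paths: from then on the ray and all later paths stay in the
  -- remaining set, which avoids the current path.
  set e := hinf.natEmbedding with he
  have hdisj : ∀ m n, m < n → (S.stage m).IsBranching → ∀ v ∈ (S.stage m).path.support,
      v ∉ (S.stage n).path.support := fun m n h hb v hv hv' =>
    (S.stage m).notMem_rest v hv (S.carrier_stage_subset_rest h hb (.inl hv'))
  refine ⟨⟨fun n => (S.stage n).head, ⟨S.injective_head_stage, S.adj_stage⟩,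
    fun i => (S.stage (e i)).head, fun i => (S.stage (e i)).tooth, fun i => (S.stage (e i)).path,
    fun i => (S.stage (e i)).isPath, fun i v hv => ⟨?_, ?_⟩, fun i j hij v hi hj => ?_⟩,
    fun i => (S.stage (e i)).infinite⟩
  · rintro ⟨n, rfl⟩
    rcases lt_trichotomy n (e i : ℕ) with h | h | h
    · exact absurd (.inl hv) (S.head_stage_notMem h)
    · rw [h]
    · exact absurd (S.carrier_stage_subset_rest h (e i).2 (S.stage n).head_mem_carrier)
        ((S.stage (e i)).notMem_rest _ hv)
  · rintro rfl
    exact ⟨e i, rfl⟩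
  · have hne : (e i : ℕ) ≠ e j := fun h => hij (e.injective (Subtype.ext h))
    rcases lt_or_gt_of_ne hne with h | h
    · exact hdisj _ _ h (e i).2 v hi hj
    · exact hdisj _ _ h (e j).2 v hj hi

end BrushStage

lemma isHereditarilyExtendable_univ_of_not_isBrush (hG : ¬ ∃ C : G.Comb, C.IsBrush) :
    G.IsHereditarilyExtendable Set.univ := by
  by_contra h
  obtain ⟨v, hv, hvC⟩ := exists_componentIn_not_extendable h
  obtain ⟨S, -, -⟩ := exists_brushStage hvC (fun w hw => componentIn_componentIn hw)
    (mem_componentIn_self hv)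
  exact hG S.exists_isBrush

end SimpleGraph

theorem mainTheorem4 {V : Type u} (G : SimpleGraph V)
    (hG : ¬ ∃ C : G.Comb, C.IsBrush) :
    ∃ π : V → Fin 2, G.IsUnfriendly π :=
  (SimpleGraph.isHereditarilyExtendable_univ_of_not_isBrush hG).exists_isUnfriendly
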